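/- Let $R$ be a commutative coherent ring (every finitely generated ideal of $R$ is finitely presented) and let $M$ be an $R$-module. A complex $T=(\cdots\to T_{i+1}\to T_i\to T_{i-1}\to\cdots)$, $i\in\mathbb{Z}$, of flat $R$-modules is called totally acyclic if it is acyclic and $I\otimes_R T$ is acyclic for every injective $R$-module $I$; an $R$-module $G$ is called Gorenstein flat if $G\cong\operatorname{Coker}(T_1\to T_0)$ for some totally acyclic complex $T$ of flat $R$-modules. A submodule $L\subseteq Q$ is called pure if $L\otimes_R N\to Q\otimes_R N$ is injective for every $R$-module $N$. If $Q\otimes_R M$ is Gorenstein flat for some faithfully flat $R$-module $Q$ that contains a non-zero free $R$-module as a pure submodule, then $M$ is Gorenstein flat. -/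

import Mathlib

universe u

open CategoryTheory TensorProduct

/-- A commutative ring is coherent if every finitely generated ideal is finitely presented. -/
def IsCoherentRing (R : Type u) [CommRing R] : Prop :=
  ∀ I : Ideal R, I.FG → Module.FinitePresentation R I

/-- A submodule `L` of `Q` is pure if `L ⊗ N → Q ⊗ N` is injective for every module `N`. -/
def Submodule.IsPureIn {R : Type u} [CommRing R] {Q : Type u} [AddCommGroup Q] [Module R Q]
    (L : Submodule R Q) : Prop :=
  ∀ (N : Type u) [AddCommGroup N] [Module R N],
    Function.Injective (LinearMap.rTensor N L.subtype)

/-- A totally acyclic complex of flat modules over a commutative ring: an acyclic complex `T`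
of flat modules (indexed by the integers, with differentials `T.X i ⟶ T.X (i - 1)`) such that
`I ⊗ T` is acyclic for every injective module `I`. -/
structure IsTotallyAcyclicFlat {R : Type u} [CommRing R]
    (T : ChainComplex (ModuleCat.{u} R) ℤ) : Prop where
  flat : ∀ i : ℤ, Module.Flat R (T.X i)
  acyclic : T.Acyclic
  tensor_acyclic : ∀ I : ModuleCat.{u} R, Module.Injective R I →
    (((MonoidalCategory.tensorLeft I).mapHomologicalComplex (ComplexShape.down ℤ)).obj T).Acyclic

/-- `G` is Gorenstein flat if it is isomorphic to the cokernel `T₀ / im (T₁ → T₀)` for some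
totally acyclic complex `T` of flat modules. -/
def IsGorensteinFlat (R : Type u) [CommRing R] (G : Type u) [AddCommGroup G] [Module R G] :
    Prop :=
  ∃ T : ChainComplex (ModuleCat.{u} R) ℤ, IsTotallyAcyclicFlat T ∧
    Nonempty ((T.X 0 ⧸ LinearMap.range (T.d 1 0).hom) ≃ₗ[R] G)

/-! Call a sequence test exact if it stays exact after tensoring with every injective module and
with `R`. Then $G$ is Gorenstein flat once it has both a flat resolution and a flat coresolution
built from test exact steps; the two halves are treated separately and spliced at $M$
(`isGorensteinFlat_of_flatSteps`).

The left half amounts to $\operatorname{Tor}_n(N,M)=0$ for $n>0$ and test modules $N$ (`TorVanish`),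
which descends from $Q\otimes M$ by faithful flatness.

For the right half, a basis vector of the pure free submodule gives a test injective map $M\to
Q\otimes M$. Composing with the first map $Q\otimes M\to T$ of a coresolution embeds $M$ in a flat
module, with cokernel $C$. The process can be iterated if $Q\otimes C$, the cokernel of $Q\otimes
M\to Q\otimes T$, again has a flat coresolution. This is `HasFlatCoresolution.of_isTestExact`,
proved by a pushout. It rests on coherence, through the flatness of character modules of injectives:
a flat $X$ is then pure in the flat module $X^{**}$. -/

/-! ### Diagram chases for `Tor₁`, flatness and purity. -/

section TensorChases

variable {R : Type u} [CommRing R] {A A' P L F G N : Type u}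
  [AddCommGroup A] [Module R A] [AddCommGroup A'] [Module R A'] [AddCommGroup P] [Module R P]
  [AddCommGroup L] [Module R L] [AddCommGroup F] [Module R F] [AddCommGroup G] [Module R G]
  [AddCommGroup N] [Module R N]

lemma LinearMap.rTensor_lTensor_apply_comm (f : A →ₗ[R] P) (g : L →ₗ[R] F) (t : A ⊗[R] L) :
    f.rTensor F (g.lTensor A t) = g.lTensor P (f.rTensor L t) := by
  rw [← LinearMap.comp_apply, ← LinearMap.comp_apply, LinearMap.rTensor_comp_lTensor,
    LinearMap.lTensor_comp_rTensor]

/-- The balancing of `Tor₁`, as far as its vanishing is concerned. -/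
theorem LinearMap.lTensor_injective_of_rTensor_injective [Module.Flat R P]
    {i : A' →ₗ[R] P} {p : P →ₗ[R] A} (hip : Function.Exact i p) (hp : Function.Surjective p)
    {j : L →ₗ[R] F} {q : F →ₗ[R] G} (hj : Function.Injective j) (hjq : Function.Exact j q)
    (hq : Function.Surjective q) (h : Function.Injective (i.rTensor G)) :
    Function.Injective (j.lTensor A) := by
  rw [injective_iff_map_eq_zero]
  intro t ht
  obtain ⟨s, rfl⟩ := LinearMap.rTensor_surjective L hp t
  rw [← LinearMap.rTensor_lTensor_apply_comm] at ht
  obtain ⟨w, hw⟩ := (rTensor_exact F hip hp _).1 ht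
  have hw0 : q.lTensor A' w = 0 := by
    apply h
    rw [LinearMap.rTensor_lTensor_apply_comm, hw, map_zero]
    exact (lTensor_exact P hjq hq).apply_apply_eq_zero s
  obtain ⟨z, rfl⟩ := (lTensor_exact A' hjq hq _).1 hw0
  rw [LinearMap.rTensor_lTensor_apply_comm] at hw
  rw [← Module.Flat.lTensor_preserves_injective_linearMap (M := P) j hj hw]
  exact (rTensor_exact L hip hp).apply_apply_eq_zero z

theorem LinearMap.rTensor_injective_of_lTensor_injective [Module.Flat R F]
    {i : A' →ₗ[R] P} {p : P →ₗ[R] A} (hi : Function.Injective i) (hip : Function.Exact i p)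
    (hp : Function.Surjective p)
    {j : L →ₗ[R] F} {q : F →ₗ[R] G} (hjq : Function.Exact j q)
    (hq : Function.Surjective q) (h : Function.Injective (j.lTensor A)) :
    Function.Injective (i.rTensor G) := by
  rw [← LinearMap.lTensor_inj_iff_rTensor_inj]
  rw [LinearMap.lTensor_inj_iff_rTensor_inj] at h
  exact LinearMap.lTensor_injective_of_rTensor_injective hjq hq hi hip hp h

lemma Module.Flat.prod [Module.Flat R F] [Module.Flat R G] : Module.Flat R (F × G) := by
  rw [Module.Flat.iff_rTensor_preserves_injective_linearMap]
  intro A P _ _ _ _ i hi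
  rw [injective_iff_map_eq_zero]
  intro t ht
  apply (TensorProduct.prodRight R R A F G).injective
  rw [map_zero]
  have h1 := congr((LinearMap.fst R F G).lTensor P $ht)
  have h2 := congr((LinearMap.snd R F G).lTensor P $ht)
  rw [map_zero, ← LinearMap.rTensor_lTensor_apply_comm] at h1 h2
  have h1 := (injective_iff_map_eq_zero _).1
    (Module.Flat.rTensor_preserves_injective_linearMap (M := F) i hi) _ h1
  have h2 := (injective_iff_map_eq_zero _).1
    (Module.Flat.rTensor_preserves_injective_linearMap (M := G) i hi) _ h2
  have h3 : (TensorProduct.prodRight R R A F G).toLinearMap =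
      ((LinearMap.fst R F G).lTensor A).prod ((LinearMap.snd R F G).lTensor A) := by
    ext <;> simp
  exact (LinearMap.congr_fun h3 t).trans (Prod.ext h1 h2)

/-- The quotient of a flat module by a pure submodule is flat. -/
theorem Module.Flat.of_exact_of_lTensor_injective [Module.Flat R F]
    {j : L →ₗ[R] F} {q : F →ₗ[R] G} (hjq : Function.Exact j q) (hq : Function.Surjective q)
    (h : ∀ (N : Type u) [AddCommGroup N] [Module R N], Function.Injective (j.lTensor N)) :
    Module.Flat R G := by
  rw [Module.Flat.iff_rTensor_preserves_injective_linearMap]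
  intro A' P _ _ _ _ i hi
  -- $\operatorname{Tor}_1(P/A',G)=0$ is read off from the pure sequence and used on $A'\to P\to
  -- P/A'$.
  exact LinearMap.rTensor_injective_of_lTensor_injective hi (LinearMap.exact_map_mkQ_range i)
    (Submodule.mkQ_surjective _) hjq hq (h _)

/-- Tensor-hom adjunction: $\operatorname{Hom}(A,N^*)=(A\otimes N)^*$, and characters detect
injectivity. -/
theorem LinearMap.lTensor_injective_iff_exists_comp_eq {f : A →ₗ[R] P} :
    Function.Injective (f.lTensor N) ↔
      ∀ c : A →ₗ[R] CharacterModule N, ∃ d : P →ₗ[R] CharacterModule N, d ∘ₗ f = c := by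
  rw [LinearMap.lTensor_inj_iff_rTensor_inj, rTensor_injective_iff_lcomp_surjective]
  rfl

end TensorChases

/-! ### Character modules and coherence. -/

namespace CharacterModule

section Eval

variable (R : Type*) [CommRing R] (A : Type*) [AddCommGroup A] [Module R A]

/-- The evaluation map into the double character module. -/
def eval : A →ₗ[R] CharacterModule (CharacterModule A) where
  toFun a :=
    { toFun := fun c => c a
      map_zero' := rfl
      map_add' := fun _ _ => rfl }
  map_add' a b := by ext c; exact map_add c a b
  map_smul' r a := by ext c; rfl

end Eval

lemma sum_apply {A : Type*} [AddCommGroup A] {ι : Type*} (s : Finset ι) (c : ι → CharacterModule A) (a : A) :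
    (∑ i ∈ s, c i) a = ∑ i ∈ s, c i a :=
  map_sum (eval ℤ A a) c s

variable {R : Type u} [CommRing R] {A N : Type u}
  [AddCommGroup A] [Module R A] [AddCommGroup N] [Module R N]

lemma lTensor_eval_injective : Function.Injective ((eval R A).lTensor N) := by
  rw [LinearMap.lTensor_injective_iff_exists_comp_eq]
  intro c
  refine ⟨dual (eval R N) ∘ₗ dual (dual c), ?_⟩
  ext a n
  rfl

/-- Over a coherent ring, the character module of an injective module is flat. -/
theorem flat_of_injective (hR : IsCoherentRing R) (J : Type u) [AddCommGroup J] [Module R J]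
    [Module.Injective R J] : Module.Flat R (CharacterModule J) := by
  refine Module.Flat.of_forall_isTrivialRelation fun {l f c} hfc => ?_
  let p : (Fin l → R) →ₗ[R] R := Fintype.linearCombination R f
  have : Module.FinitePresentation R (LinearMap.range p) :=
    hR _ (by rw [LinearMap.range_eq_map]; exact Submodule.FG.map p Module.Finite.fg_top)
  -- Coherence enters here: the relations among the `f i` are generated by finitely many `b j`.
  have hker : (LinearMap.ker p).FG := by
    rw [← LinearMap.ker_rangeRestrict]
    exact Module.FinitePresentation.fg_ker _ p.surjective_rangeRestrict
  obtain ⟨k, b, hb⟩ := Submodule.fg_iff_exists_fin_generating_family.1 hker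
  let α : (Fin l → J) →ₗ[R] (Fin k → J) :=
    LinearMap.pi fun j => ∑ i, b j i • LinearMap.proj i
  let C : CharacterModule (Fin l → J) := ∑ i, dual (LinearMap.proj i : _ →ₗ[R] J) (c i)
  have hα (x j) : α x j = ∑ i, b j i • x i := by simp [α]
  have hC (x) : C x = ∑ i, c i (x i) := by
    exact sum_apply _ _ x
  -- If `x` is killed by all `b j`, then $f_i\mapsto x_i$ is well defined on the ideal $(f_i)$.
  -- Injectivity of `J` extends it to `R`, so $x_i=f_iy$ and the relation among the `c i` kills `x`.
  have hCα (x) (hx : α x = 0) : C x = 0 := by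
    let φ : (Fin l → R) →ₗ[R] J := Fintype.linearCombination R x
    have hφ : LinearMap.ker p ≤ LinearMap.ker φ := by
      rw [← hb, Submodule.span_le]
      rintro _ ⟨j, rfl⟩
      have := congr_fun hx j
      rw [hα] at this
      simpa [φ, Fintype.linearCombination_apply] using this
    let ψ := (LinearMap.ker p).liftQ φ hφ
    obtain ⟨χ, hχ⟩ := Module.Injective.extension_property R J _ _
      ((LinearMap.ker p).liftQ p le_rfl)
      (LinearMap.ker_eq_bot.1 (Submodule.ker_liftQ_eq_bot _ _ _ le_rfl)) ψ
    have hxi (i) : x i = f i • χ 1 := by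
      have := LinearMap.congr_fun hχ (Submodule.Quotient.mk (Pi.single i 1))
      simp only [LinearMap.comp_apply, Submodule.liftQ_apply, ψ, φ, p,
        Fintype.linearCombination_apply_single, one_smul] at this
      rw [← this, ← map_smul, smul_eq_mul, mul_one]
    rw [hC]
    have := congr($hfc (χ 1))
    rw [sum_apply] at this
    simp only [hxi]
    exact this
  -- So `C` factors through the image of `α` and extends to a character `Y` of $J^k$, whose
  -- components trivialize the relation.
  obtain ⟨Y, hY⟩ := dual_surjective_of_injective ((LinearMap.ker α).liftQ α le_rfl)
    (LinearMap.ker_eq_bot.1 (Submodule.ker_liftQ_eq_bot _ _ _ le_rfl))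
    (QuotientAddGroup.lift (LinearMap.ker α).toAddSubgroup C fun x hx => hCα x hx)
  have hYα (x) : Y (α x) = C x := congr($hY (Submodule.Quotient.mk x))
  refine ⟨k, fun i j => b j i, fun j => dual (LinearMap.single R (fun _ => J) j) Y, ?_, ?_⟩
  · intro i
    ext x
    have h1 := hYα (Pi.single i x)
    have h3 : C (Pi.single i x) = c i x := by
      rw [hC, Finset.sum_eq_single i]
      · simp
      · intro j _ hj; simp [Pi.single_eq_of_ne hj]
      · simp
    have h4 : α (Pi.single i x) = ∑ j, Pi.single j (b j i • x) := by
      ext j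
      rw [hα, Finset.sum_apply, Finset.sum_eq_single i, Finset.sum_eq_single j]
      · simp
      · intro j' _ hj; simp [Pi.single_eq_of_ne hj.symm]
      · simp
      · intro j' _ hj; simp [Pi.single_eq_of_ne hj]
      · simp
    rw [← h3, ← h1, h4, map_sum, sum_apply]
    rfl
  · intro j
    have : b j ∈ LinearMap.ker p := hb ▸ Submodule.subset_span ⟨j, rfl⟩
    simpa [p, Fintype.linearCombination_apply, mul_comm] using this

end CharacterModule

/-! ### Test exact sequences and flat coresolutions. -/

section TestModules

variable (R : Type u) [CommRing R]

/-- The modules against which the exactness of totally acyclic complexes is tested: the injective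
modules and the ring itself. -/
def IsTestModule (N : Type u) [AddCommGroup N] [Module R N] : Prop :=
  Module.Injective R N ∨ Nonempty (N ≃ₗ[R] R)

lemma isTestModule_self : IsTestModule R R := Or.inr ⟨LinearEquiv.refl R R⟩

variable {R} {X F Y D E T : Type u} [AddCommGroup X] [Module R X] [AddCommGroup F] [Module R F]
  [AddCommGroup Y] [Module R Y] [AddCommGroup D] [Module R D] [AddCommGroup E] [Module R E]
  [AddCommGroup T] [Module R T]

/-- A linear map that stays injective after tensoring with any test module. -/
def LinearMap.TestInjective (f : X →ₗ[R] F) : Prop :=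
  ∀ (N : Type u) [AddCommGroup N] [Module R N], IsTestModule R N →
    Function.Injective (f.lTensor N)

/-- A short exact sequence that stays exact after tensoring with any test module. -/
structure IsTestExact (f : X →ₗ[R] F) (g : F →ₗ[R] Y) : Prop where
  testInjective : f.TestInjective
  exact : Function.Exact f g
  surjective : Function.Surjective g

lemma LinearMap.injective_of_lTensor_equiv {N : Type u} [AddCommGroup N] [Module R N]
    (e : N ≃ₗ[R] R) {f : X →ₗ[R] F} (h : Function.Injective (f.lTensor N)) :
    Function.Injective f := by
  intro x y hxy
  have : e.symm 1 ⊗ₜ[R] x = e.symm 1 ⊗ₜ[R] y := h (by simp [hxy])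
  have := congr(TensorProduct.lid R X (e.rTensor X $this))
  simpa using this

lemma LinearMap.TestInjective.injective {f : X →ₗ[R] F} (hf : f.TestInjective) :
    Function.Injective f :=
  LinearMap.injective_of_lTensor_equiv (LinearEquiv.refl R R) (hf R (isTestModule_self R))

lemma LinearMap.TestInjective.comp {f : X →ₗ[R] F} {g : F →ₗ[R] Y} (hg : g.TestInjective)
    (hf : f.TestInjective) : (g ∘ₗ f).TestInjective := by
  intro N _ _ hN
  rw [LinearMap.lTensor_comp, LinearMap.coe_comp]
  exact (hg N hN).comp (hf N hN)

lemma LinearMap.TestInjective.isTestExact_mkQ {f : X →ₗ[R] F} (hf : f.TestInjective) :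
    IsTestExact f (LinearMap.range f).mkQ :=
  ⟨hf, LinearMap.exact_map_mkQ_range f, Submodule.mkQ_surjective _⟩

lemma Function.Exact.exists_comp_eq {f : X →ₗ[R] F} {g : F →ₗ[R] Y} (h : Function.Exact f g)
    (hg : Function.Surjective g) (φ : F →ₗ[R] D) (hφ : φ ∘ₗ f = 0) :
    ∃ ψ : Y →ₗ[R] D, ψ ∘ₗ g = φ := by
  have hk : LinearMap.ker g ≤ LinearMap.ker φ := by
    intro x hx
    obtain ⟨y, rfl⟩ := (h x).1 hx
    exact LinearMap.congr_fun hφ y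
  refine ⟨(LinearMap.ker g).liftQ φ hk ∘ₗ (g.quotKerEquivOfSurjective hg).symm.toLinearMap, ?_⟩
  ext x
  have : (g.quotKerEquivOfSurjective hg).symm (g x) = Submodule.Quotient.mk x := by
    rw [LinearEquiv.symm_apply_eq]; rfl
  simp [this]

/-- Test injective maps from a flat module extend the map to its double character module. -/
lemma LinearMap.TestInjective.exists_comp_eq_eval [Module.Flat R X] {f : X →ₗ[R] D}
    (hf : f.TestInjective) :
    ∃ φ : D →ₗ[R] CharacterModule (CharacterModule X), φ ∘ₗ f = CharacterModule.eval R X :=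
  -- Since `X` is flat, $X^*$ is injective, hence a test module.
  LinearMap.lTensor_injective_iff_exists_comp_eq.1
    (hf _ (Or.inl (Module.Flat.iff_characterModule_injective.1 ‹_›))) _

/-- Test injective maps from a flat module are pure. -/
lemma LinearMap.TestInjective.lTensor_injective [Module.Flat R X] {f : X →ₗ[R] D}
    (hf : f.TestInjective) (N : Type u) [AddCommGroup N] [Module R N] :
    Function.Injective (f.lTensor N) := by
  obtain ⟨φ, hφ⟩ := hf.exists_comp_eq_eval
  have := CharacterModule.lTensor_eval_injective (R := R) (A := X) (N := N)
  rw [← hφ, LinearMap.lTensor_comp, LinearMap.coe_comp] at this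
  exact this.of_comp

lemma IsTestExact.lTensor (Q : Type u) [AddCommGroup Q] [Module R Q] [Module.Flat R Q]
    {f : X →ₗ[R] F} {g : F →ₗ[R] Y} (h : IsTestExact f g) :
    IsTestExact (f.lTensor Q) (g.lTensor Q) := by
  refine ⟨fun N _ _ hN => ?_, lTensor_exact Q h.exact h.surjective,
    LinearMap.lTensor_surjective Q h.surjective⟩
  have h1 := Module.Flat.lTensor_preserves_injective_linearMap (M := Q) _
    (h.testInjective N hN)
  have h2 : (f.lTensor Q).lTensor N = (TensorProduct.leftComm R Q N F).toLinearMap ∘ₗ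
      ((f.lTensor N).lTensor Q) ∘ₗ (TensorProduct.leftComm R N Q X).toLinearMap := by
    ext; simp
  rw [h2]
  simpa using h1

/-- In a pushout square, cokernels agree. -/
lemma IsTestExact.exists_of_pushout {u : X →ₗ[R] F} {v : F →ₗ[R] Y} (h : IsTestExact u v)
    {a : X →ₗ[R] T} {i : F →ₗ[R] D} {j : T →ₗ[R] D} (hs : Function.Surjective (i.coprod j))
    (hij : Function.Exact (u.prod (-a)) (i.coprod j)) :
    ∃ π : D →ₗ[R] Y, IsTestExact j π := by
  have hui (x : X) : i (u x) = j (a x) := by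
    have := hij.apply_apply_eq_zero x
    simpa [← sub_eq_add_neg, sub_eq_zero] using this
  obtain ⟨π, hπ⟩ := hij.exists_comp_eq hs (v ∘ₗ LinearMap.fst R F T)
    (by ext x; simpa using h.exact.apply_apply_eq_zero x)
  have hπi (x : F) : π (i x) = v x := by simpa using LinearMap.congr_fun hπ (x, 0)
  have hπj (x : T) : π (j x) = 0 := by simpa using LinearMap.congr_fun hπ (0, x)
  refine ⟨π, fun N _ _ hN => ?_, fun d => ⟨fun hd => ?_, ?_⟩, fun y => ?_⟩
  · rw [injective_iff_map_eq_zero]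
    intro t ht
    have h1 : (i.coprod j).lTensor N ((LinearMap.inr R F T).lTensor N t) = 0 := by
      rw [← LinearMap.comp_apply, ← LinearMap.lTensor_comp, LinearMap.coprod_inr, ht]
    -- Here $(0,t)=(u(s),-a(s))$ after tensoring, so $s=0$ and then $t=0$.
    obtain ⟨s, hst⟩ := (lTensor_exact N hij hs _).1 h1
    have h2 := congr((LinearMap.fst R F T).lTensor N $hst)
    simp only [← LinearMap.comp_apply, ← LinearMap.lTensor_comp, LinearMap.fst_prod,
      LinearMap.fst_comp_inr, LinearMap.lTensor_zero, LinearMap.zero_apply] at h2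
    rw [(injective_iff_map_eq_zero _).1 (h.testInjective N hN) s h2, map_zero] at hst
    have h3 := congr((LinearMap.snd R F T).lTensor N $hst)
    simpa only [← LinearMap.comp_apply, ← LinearMap.lTensor_comp, LinearMap.snd_comp_inr,
      LinearMap.lTensor_id, LinearMap.id_apply, map_zero, eq_comm] using h3
  · obtain ⟨⟨x, t⟩, rfl⟩ := hs d
    simp only [LinearMap.coprod_apply, map_add, hπi, hπj, add_zero] at hd
    obtain ⟨z, rfl⟩ := (h.exact x).1 hd
    exact ⟨a z + t, by simp [hui]⟩
  · rintro ⟨t, rfl⟩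
    exact hπj t
  · obtain ⟨x, rfl⟩ := h.surjective y
    exact ⟨i x, hπi x⟩

/-- There is a short exact sequence `0 → X → F → Y → 0` with `F` flat that stays exact after
tensoring with any test module. -/
def IsFlatStep (X Y : ModuleCat.{u} R) : Prop :=
  ∃ (F : ModuleCat.{u} R) (f : X →ₗ[R] F) (g : F →ₗ[R] Y), Module.Flat R F ∧ IsTestExact f g

variable (R X) in
/-- `X` is the start of a flat coresolution that is exact after tensoring with test modules. -/
def HasFlatCoresolution : Prop :=
  ∃ P : ModuleCat.{u} R → Prop, P (ModuleCat.of R X) ∧ ∀ Y, P Y → ∃ Z, IsFlatStep Y Z ∧ P Z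

/-- The definition is coinductive: `P` is an invariant that also witnesses the coresolution of the
next cokernel. -/
lemma HasFlatCoresolution.exists_step (h : HasFlatCoresolution R X) :
    ∃ (T : Type u) (_ : AddCommGroup T) (_ : Module R T) (E : Type u) (_ : AddCommGroup E)
      (_ : Module R E) (f : X →ₗ[R] T) (g : T →ₗ[R] E), Module.Flat R T ∧ IsTestExact f g ∧
        HasFlatCoresolution R E := by
  obtain ⟨P, hP, hstep⟩ := h
  obtain ⟨Z, ⟨F, f, g, hF, hfg⟩, hZ⟩ := hstep _ hP
  exact ⟨F, _, _, Z, _, _, f, g, hF, hfg, P, hZ, hstep⟩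

lemma HasFlatCoresolution.of_step [Module.Flat R F] {f : X →ₗ[R] F} {g : F →ₗ[R] Y}
    (hfg : IsTestExact f g) (h : HasFlatCoresolution R Y) : HasFlatCoresolution R X := by
  obtain ⟨P, hP, hstep⟩ := h
  refine ⟨fun Z => P Z ∨ Z = ModuleCat.of R X, Or.inr rfl, ?_⟩
  rintro Z (hZ | rfl)
  · obtain ⟨W, hW, hPW⟩ := hstep Z hZ
    exact ⟨W, hW, Or.inl hPW⟩
  · exact ⟨ModuleCat.of R Y, ⟨ModuleCat.of R F, f, g, ‹_›, hfg⟩, Or.inl hP⟩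

/-- One step of a coresolution of an extension by a flat module. -/
lemma IsTestExact.exists_step_of_flat (hR : IsCoherentRing R) [Module.Flat R X] {j : X →ₗ[R] D}
    {π : D →ₗ[R] E} (h : IsTestExact j π) {Z : Type u} [AddCommGroup Z] [Module R Z]
    [Module.Flat R T] {a : E →ₗ[R] T} {b : T →ₗ[R] Z} (hab : IsTestExact a b) :
    ∃ (F C X' : Type u) (_ : AddCommGroup F) (_ : Module R F) (_ : AddCommGroup C)
      (_ : Module R C) (_ : AddCommGroup X') (_ : Module R X') (f : D →ₗ[R] F) (g : F →ₗ[R] C)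
      (j' : X' →ₗ[R] C) (π' : C →ₗ[R] Z), Module.Flat R F ∧ IsTestExact f g ∧
        Module.Flat R X' ∧ IsTestExact j' π' := by
  have : Module.Injective R (CharacterModule X) := Module.Flat.iff_characterModule_injective.1 ‹_›
  let W := CharacterModule (CharacterModule X)
  have hW : Module.Flat R W := CharacterModule.flat_of_injective hR _
  let ε : X →ₗ[R] W := CharacterModule.eval R X
  have hε (N : Type u) [AddCommGroup N] [Module R N] : Function.Injective (ε.lTensor N) :=
    CharacterModule.lTensor_eval_injective
  obtain ⟨φ, hφ : φ ∘ₗ j = ε⟩ := h.testInjective.exists_comp_eq_eval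
  -- A horseshoe construction: `φ` extends $X\to X^{**}$ to `D`, in place of the injectivity usually
  -- required. The cokernel is an extension of `Z` by the flat module $X^{**}/X$.
  let f : D →ₗ[R] W × T := φ.prod (a ∘ₗ π)
  have key (N : Type u) [AddCommGroup N] [Module R N] (hN : IsTestModule R N) (d : N ⊗[R] D)
      (w : N ⊗[R] W) (hd : f.lTensor N d = (LinearMap.inl R W T).lTensor N w) :
      ∃ x, j.lTensor N x = d ∧ ε.lTensor N x = w := by
    have h1 := congr((LinearMap.fst R W T).lTensor N $hd)
    have h2 := congr((LinearMap.snd R W T).lTensor N $hd)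
    simp only [f, ← LinearMap.comp_apply, ← LinearMap.lTensor_comp, LinearMap.fst_prod,
      LinearMap.snd_prod, LinearMap.fst_comp_inl, LinearMap.snd_comp_inl,
      LinearMap.lTensor_zero, LinearMap.zero_apply, LinearMap.lTensor_id, LinearMap.id_apply]
      at h1 h2
    rw [LinearMap.lTensor_comp, LinearMap.comp_apply] at h2
    have h3 := (injective_iff_map_eq_zero _).1 (hab.testInjective N hN) _ h2
    obtain ⟨x, rfl⟩ := (lTensor_exact N h.exact h.surjective _).1 h3
    refine ⟨x, rfl, ?_⟩
    rw [← h1, ← hφ, LinearMap.lTensor_comp, LinearMap.comp_apply]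
  have hf : f.TestInjective := by
    intro N _ _ hN
    rw [injective_iff_map_eq_zero]
    intro d hd
    obtain ⟨x, rfl, hx⟩ := key N hN d 0 (by rw [hd, map_zero])
    rw [(injective_iff_map_eq_zero _).1 (hε N) x hx, map_zero]
  let C := (W × T) ⧸ LinearMap.range f
  let g : W × T →ₗ[R] C := (LinearMap.range f).mkQ
  have hfg : IsTestExact f g := hf.isTestExact_mkQ
  let X' := W ⧸ LinearMap.range ε
  have hεX : Function.Exact ε (LinearMap.range ε).mkQ := LinearMap.exact_map_mkQ_range ε
  have hX' : Module.Flat R X' :=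
    Module.Flat.of_exact_of_lTensor_injective hεX (Submodule.mkQ_surjective _) hε
  obtain ⟨j', hj'⟩ := hεX.exists_comp_eq (Submodule.mkQ_surjective _)
    (g ∘ₗ LinearMap.inl R W T) (by
      ext x
      refine (hfg.exact _).2 ⟨j x, ?_⟩
      ext1
      · exact LinearMap.congr_fun hφ x
      · simp [f, h.exact.apply_apply_eq_zero x])
  obtain ⟨π', hπ'⟩ := hfg.exact.exists_comp_eq hfg.surjective (b ∘ₗ LinearMap.snd R W T)
    (by ext d; exact hab.exact.apply_apply_eq_zero (π d))
  refine ⟨W × T, C, X', _, _, _, _, _, _, f, g, j', π', Module.Flat.prod, hfg, hX',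
    fun N _ _ hN => ?_, fun c => ⟨fun hc => ?_, ?_⟩, fun z => ?_⟩
  · rw [injective_iff_map_eq_zero]
    intro t ht
    obtain ⟨w, rfl⟩ := LinearMap.lTensor_surjective N (Submodule.mkQ_surjective _) t
    rw [← LinearMap.comp_apply, ← LinearMap.lTensor_comp, hj', LinearMap.lTensor_comp,
      LinearMap.comp_apply] at ht
    obtain ⟨d, hd⟩ := (lTensor_exact N hfg.exact hfg.surjective _).1 ht
    obtain ⟨x, -, rfl⟩ := key N hN d w hd
    exact (lTensor_exact N hεX (Submodule.mkQ_surjective _)).apply_apply_eq_zero x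
  · obtain ⟨⟨w, t⟩, rfl⟩ := hfg.surjective c
    have hbt : b t = 0 := (LinearMap.congr_fun hπ' (w, t)).symm.trans hc
    obtain ⟨e, rfl⟩ := (hab.exact t).1 hbt
    obtain ⟨d, rfl⟩ := h.surjective e
    refine ⟨(LinearMap.range ε).mkQ (w - φ d), (LinearMap.congr_fun hj' _).trans ?_⟩
    refine sub_eq_zero.1 ?_
    rw [LinearMap.comp_apply, ← map_sub]
    refine (hfg.exact _).2 ⟨-d, ?_⟩
    ext1 <;> simp [f]
  · rintro ⟨x, rfl⟩
    obtain ⟨w, rfl⟩ := Submodule.mkQ_surjective _ x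
    rw [← LinearMap.comp_apply j', hj', LinearMap.comp_apply, ← LinearMap.comp_apply π', hπ']
    simp
  · obtain ⟨t, rfl⟩ := hab.surjective z
    exact ⟨g (0, t), LinearMap.congr_fun hπ' (0, t)⟩

/-- Over a coherent ring, flat coresolutions exist for extensions by flat modules. -/
lemma HasFlatCoresolution.of_extension (hR : IsCoherentRing R) [Module.Flat R X]
    {j : X →ₗ[R] D} {π : D →ₗ[R] E} (h : IsTestExact j π) (hE : HasFlatCoresolution R E) :
    HasFlatCoresolution R D := by
  refine ⟨fun D => ∃ (X E : ModuleCat.{u} R) (j : X →ₗ[R] D) (π : D →ₗ[R] E), Module.Flat R X ∧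
    IsTestExact j π ∧ HasFlatCoresolution R E,
    ⟨ModuleCat.of R X, ModuleCat.of R E, j, π, ‹_›, h, hE⟩, ?_⟩
  rintro D ⟨X, E, j, π, hX, h, hE⟩
  obtain ⟨T, _, _, Z, _, _, a, b, hT, hab, hZ⟩ := hE.exists_step
  obtain ⟨F, C, X', _, _, _, _, _, _, f, g, j', π', hF, hfg, hX', h'⟩ :=
    h.exists_step_of_flat hR hab
  exact ⟨ModuleCat.of R C, ⟨ModuleCat.of R F, f, g, hF, hfg⟩,
    ModuleCat.of R X', ModuleCat.of R Z, j', π', hX', h', hZ⟩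

/-- Embed `D` in a flat `K` with cokernel `E`. The flat module `T` is then pure in `K`, so $K/T$ is
flat, and $Y=D/T$ embeds in it with the same cokernel `E`. -/
lemma HasFlatCoresolution.of_quotient [Module.Flat R T] {j : T →ₗ[R] D} {π : D →ₗ[R] Y}
    (h : IsTestExact j π) (hD : HasFlatCoresolution R D) : HasFlatCoresolution R Y := by
  obtain ⟨K, _, _, E, _, _, a, b, hK, hab, hE⟩ := hD.exists_step
  have haj := (hab.testInjective.comp h.testInjective).isTestExact_mkQ
  let K' := K ⧸ LinearMap.range (a ∘ₗ j)
  let q : K →ₗ[R] K' := (LinearMap.range (a ∘ₗ j)).mkQ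
  have : Module.Flat R K' := Module.Flat.of_exact_of_lTensor_injective haj.exact haj.surjective
    haj.testInjective.lTensor_injective
  obtain ⟨f, hf⟩ := h.exact.exists_comp_eq h.surjective (q ∘ₗ a)
    (by ext t; exact haj.exact.apply_apply_eq_zero t)
  obtain ⟨g, hg⟩ := haj.exact.exists_comp_eq haj.surjective b
    (by ext t; exact hab.exact.apply_apply_eq_zero (j t))
  refine HasFlatCoresolution.of_step (f := f) (g := g)
    ⟨fun N _ _ hN => ?_, fun k => ⟨fun hk => ?_, ?_⟩, fun e => ?_⟩ hE
  · rw [injective_iff_map_eq_zero]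
    intro t ht
    obtain ⟨d, rfl⟩ := LinearMap.lTensor_surjective N h.surjective t
    rw [← LinearMap.comp_apply, ← LinearMap.lTensor_comp, hf, LinearMap.lTensor_comp,
      LinearMap.comp_apply] at ht
    obtain ⟨s, hs⟩ := (lTensor_exact N haj.exact haj.surjective _).1 ht
    rw [LinearMap.lTensor_comp, LinearMap.comp_apply] at hs
    rw [← hab.testInjective N hN hs]
    exact (lTensor_exact N h.exact h.surjective).apply_apply_eq_zero s
  · obtain ⟨k, rfl⟩ := haj.surjective k
    obtain ⟨d, rfl⟩ := (hab.exact k).1 ((LinearMap.congr_fun hg k).symm.trans hk)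
    exact ⟨π d, LinearMap.congr_fun hf d⟩
  · rintro ⟨y, rfl⟩
    obtain ⟨d, rfl⟩ := h.surjective y
    rw [← LinearMap.comp_apply f, hf, LinearMap.comp_apply, ← LinearMap.comp_apply g]
    exact (LinearMap.congr_fun hg (a d)).trans (hab.exact.apply_apply_eq_zero d)
  · obtain ⟨k, rfl⟩ := hab.surjective e
    exact ⟨q k, LinearMap.congr_fun hg k⟩

/-- Over a coherent ring, the cokernel of any test injective map from a module with a flat
coresolution to a flat module has a flat coresolution. -/
theorem HasFlatCoresolution.of_isTestExact (hR : IsCoherentRing R) [Module.Flat R F]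
    {f : X →ₗ[R] F} {g : F →ₗ[R] Y} (h : IsTestExact f g) (hX : HasFlatCoresolution R X) :
    HasFlatCoresolution R Y := by
  obtain ⟨T, _, _, E, _, _, a, b, hT, hab, hE⟩ := hX.exists_step
  -- The pushout of $F\leftarrow X\to T$: an extension of `E` by the flat `F`, and of `Y` by the
  -- flat `T`.
  let D := (F × T) ⧸ LinearMap.range (f.prod (-a))
  let q : F × T →ₗ[R] D := (LinearMap.range (f.prod (-a))).mkQ
  let i : F →ₗ[R] D := q ∘ₗ LinearMap.inl R F T
  let j : T →ₗ[R] D := q ∘ₗ LinearMap.inr R F T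
  have hq : i.coprod j = q := by ext <;> simp [i, j]
  have hqs : Function.Surjective q := Submodule.mkQ_surjective _
  have hqe : Function.Exact (f.prod (-a)) q := LinearMap.exact_map_mkQ_range _
  have hswap (t : T) (x : F) : (j.coprod i) (t, x) = q (x, t) := by
    rw [← hq]; simp [add_comm]
  obtain ⟨π, hπ⟩ := h.exists_of_pushout (a := a) (i := i) (j := j) (hq ▸ hqs) (hq ▸ hqe)
  obtain ⟨ρ, hρ⟩ := hab.exists_of_pushout (a := f) (i := j) (j := i)
    (fun d => by
      obtain ⟨⟨x, t⟩, rfl⟩ := hqs d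
      exact ⟨(t, x), hswap t x⟩)
    (by
      rintro ⟨t, x⟩
      rw [hswap, hqe (x, t)]
      constructor <;> rintro ⟨z, hz⟩ <;> refine ⟨-z, ?_⟩ <;>
        simp only [LinearMap.prod_apply, Function.prod_apply, Prod.mk.injEq] at hz ⊢ <;>
        simp [← hz.1, ← hz.2])
  exact HasFlatCoresolution.of_quotient hπ (HasFlatCoresolution.of_extension hR hρ hE)

end TestModules

/-! ### Flat resolutions and vanishing of Tor. -/

section FlatResolutions

variable {R : Type u} [CommRing R]

/-- The kernel of the canonical free cover of a module. -/
noncomputable def ModuleCat.syzygy (A : ModuleCat.{u} R) : ModuleCat.{u} R :=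
  ModuleCat.of R (LinearMap.ker (Finsupp.linearCombination R (id : A → A)))

/-- The inclusion of the syzygy into the canonical free cover. -/
noncomputable def ModuleCat.syzygyι (A : ModuleCat.{u} R) : A.syzygy →ₗ[R] (A →₀ R) :=
  (LinearMap.ker (Finsupp.linearCombination R (id : A → A))).subtype

lemma ModuleCat.syzygyι_injective (A : ModuleCat.{u} R) : Function.Injective A.syzygyι :=
  Submodule.injective_subtype _

lemma ModuleCat.syzygyι_exact (A : ModuleCat.{u} R) :
    Function.Exact A.syzygyι (Finsupp.linearCombination R (id : A → A)) :=
  LinearMap.exact_subtype_ker_map _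

lemma ModuleCat.linearCombination_id_surjective (A : ModuleCat.{u} R) :
    Function.Surjective (Finsupp.linearCombination R (id : A → A)) :=
  Finsupp.linearCombination_id_surjective R A

/-- The vanishing of `Tor₁(A, X)`. -/
def TorOneVanish (A : ModuleCat.{u} R) (X : Type u) [AddCommGroup X] [Module R X] : Prop :=
  Function.Injective (A.syzygyι.rTensor X)

variable (R) in
/-- The vanishing of `Torₙ(N, X)` for all `n > 0` and all test modules `N`. -/
def TorVanish (X : Type u) [AddCommGroup X] [Module R X] : Prop :=
  ∀ N : ModuleCat.{u} R, IsTestModule R N → ∀ n : ℕ, TorOneVanish (ModuleCat.syzygy^[n] N) X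

variable {X F Y : Type u} [AddCommGroup X] [Module R X] [AddCommGroup F] [Module R F]
  [AddCommGroup Y] [Module R Y]

/-- Dimension shifting. -/
lemma torOneVanish_syzygy_iff [Module.Flat R F] {f : Y →ₗ[R] F} {g : F →ₗ[R] X}
    (hf : Function.Injective f) (hfg : Function.Exact f g) (hg : Function.Surjective g)
    (A : ModuleCat.{u} R) : TorOneVanish A.syzygy X ↔ TorOneVanish A Y := by
  have h1 : TorOneVanish A.syzygy X ↔ Function.Injective (f.lTensor A.syzygy) :=
    ⟨fun h => LinearMap.lTensor_injective_of_rTensor_injective A.syzygy.syzygyι_exact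
        A.syzygy.linearCombination_id_surjective hf hfg hg h,
      fun h => LinearMap.rTensor_injective_of_lTensor_injective A.syzygy.syzygyι_injective
        A.syzygy.syzygyι_exact A.syzygy.linearCombination_id_surjective hfg hg h⟩
  -- Both vanishing conditions become injectivity of the same map from $A.\mathrm{syzygy}\otimes Y$
  -- to $(A\to_0 R)\otimes F$.
  have h2 : (A.syzygyι.rTensor F) ∘ₗ f.lTensor A.syzygy =
      f.lTensor (A →₀ R) ∘ₗ A.syzygyι.rTensor Y :=
    LinearMap.ext fun t => LinearMap.rTensor_lTensor_apply_comm _ _ t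
  have h3 := Module.Flat.rTensor_preserves_injective_linearMap (M := F) _ A.syzygyι_injective
  have h4 := Module.Flat.lTensor_preserves_injective_linearMap (M := A →₀ R) _ hf
  rw [h1, TorOneVanish, ← h3.of_comp_iff, ← h4.of_comp_iff, ← LinearMap.coe_comp,
    ← LinearMap.coe_comp, h2]

lemma torVanish_of_flatSteps (S : ℕ → ModuleCat.{u} R) (hS : ∀ n, IsFlatStep (S (n + 1)) (S n)) :
    TorVanish R (S 0) := by
  intro N hN n
  -- The condition at the `n`-th syzygy is $\operatorname{Tor}_{n+1}(N,S_i)=0$; shifting lowers `n`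
  -- and raises `i`.
  suffices ∀ i, TorOneVanish (ModuleCat.syzygy^[n] N) (S i) from this 0
  induction n with
  | zero =>
    intro i
    obtain ⟨F, f, g, hF, hfg⟩ := hS i
    exact LinearMap.rTensor_injective_of_lTensor_injective N.syzygyι_injective N.syzygyι_exact
      N.linearCombination_id_surjective hfg.exact hfg.surjective (hfg.testInjective N hN)
  | succ n ih =>
    intro i
    obtain ⟨F, f, g, hF, hfg⟩ := hS i
    rw [Function.iterate_succ_apply', torOneVanish_syzygy_iff hfg.testInjective.injective
      hfg.exact hfg.surjective]
    exact ih (i + 1)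

lemma TorVanish.exists_isFlatStep {X : ModuleCat.{u} R} (h : TorVanish R X) :
    ∃ Y, IsFlatStep Y X ∧ TorVanish R Y := by
  refine ⟨X.syzygy, ⟨ModuleCat.of R (X →₀ R), X.syzygyι,
    Finsupp.linearCombination R (id : X → X),
    inferInstanceAs (Module.Flat R (X →₀ R)), fun N _ _ hN => ?_, X.syzygyι_exact,
    X.linearCombination_id_surjective⟩, fun N hN n => ?_⟩
  · exact LinearMap.lTensor_injective_of_rTensor_injective
      (ModuleCat.of R N).syzygyι_exact (ModuleCat.of R N).linearCombination_id_surjective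
      X.syzygyι_injective X.syzygyι_exact X.linearCombination_id_surjective
      (h (ModuleCat.of R N) hN 0)
  · rw [← torOneVanish_syzygy_iff X.syzygyι_injective X.syzygyι_exact
      X.linearCombination_id_surjective,
      ← Function.iterate_succ_apply' ModuleCat.syzygy]
    exact h N hN (n + 1)

lemma TorVanish.of_equiv (e : X ≃ₗ[R] Y) (h : TorVanish R X) : TorVanish R Y := by
  intro N hN n
  refine (Function.Injective.of_comp_iff' _ (e.lTensor _).bijective).1 ?_
  have : (ModuleCat.syzygyι (ModuleCat.syzygy^[n] N)).rTensor Y ∘ₗ e.toLinearMap.lTensor _ =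
      e.toLinearMap.lTensor _ ∘ₗ (ModuleCat.syzygyι (ModuleCat.syzygy^[n] N)).rTensor X :=
    LinearMap.ext fun t => LinearMap.rTensor_lTensor_apply_comm _ _ t
  refine (congrArg (fun φ => Function.Injective φ) (congrArg DFunLike.coe this)).mpr ?_
  rw [LinearMap.coe_comp]
  exact (e.lTensor _).injective.comp (h N hN n)

lemma LinearMap.rTensor_injective_of_faithfullyFlat (Q : Type u) [AddCommGroup Q] [Module R Q]
    [Module.FaithfullyFlat R Q] (i : Y →ₗ[R] F) (h : Function.Injective (i.rTensor (Q ⊗[R] X))) :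
    Function.Injective (i.rTensor X) := by
  refine (Module.FaithfullyFlat.lTensor_injective_iff_injective R Q
    (i.rTensor X)).1 ?_
  have h2 : (i.rTensor X).lTensor Q = (TensorProduct.leftComm R F Q X).toLinearMap ∘ₗ
      (i.rTensor (Q ⊗[R] X)) ∘ₗ (TensorProduct.leftComm R Q Y X).toLinearMap := by
    ext; simp
  rw [h2]
  simpa using h

/-- The vanishing of `Tor` descends along faithfully flat modules. -/
lemma TorVanish.of_tensorProduct (Q : Type u) [AddCommGroup Q] [Module R Q]
    [Module.FaithfullyFlat R Q] (h : TorVanish R (Q ⊗[R] X)) : TorVanish R X := by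
  intro N hN n
  exact LinearMap.rTensor_injective_of_faithfullyFlat Q _ (h N hN n)

end FlatResolutions

/-! ### Descent of flat coresolutions from $Q\otimes M$ to $M$. -/

section FlatCoresolutions

variable {R : Type u} [CommRing R] {X Y M Q : Type u} [AddCommGroup X] [Module R X]
  [AddCommGroup Y] [Module R Y] [AddCommGroup M] [Module R M] [AddCommGroup Q] [Module R Q]

lemma HasFlatCoresolution.of_equiv (e : X ≃ₗ[R] Y) (h : HasFlatCoresolution R X) :
    HasFlatCoresolution R Y := by
  obtain ⟨T, _, _, E, _, _, f, g, hT, hfg, hE⟩ := h.exists_step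
  refine .of_step (f := f ∘ₗ e.symm.toLinearMap) (g := g) ⟨hfg.testInjective.comp ?_, ?_,
    hfg.surjective⟩ hE
  · intro N _ _ _
    exact (e.symm.lTensor N).injective
  · rw [LinearMap.coe_comp]
    exact (Function.Surjective.comp_exact_iff_exact e.symm.surjective).2 hfg.exact

/-- If `Q` contains a nonzero free pure submodule, then `M` is a pure submodule of `Q ⊗ M`. -/
lemma Submodule.IsPureIn.exists_testInjective {L : Submodule R Q} (hL : L.IsPureIn)
    (hbot : L ≠ ⊥) [Module.Free R L] : ∃ m : M →ₗ[R] Q ⊗[R] M, m.TestInjective := by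
  have := (Submodule.nontrivial_iff_ne_bot).2 hbot
  let b := Module.Free.chooseBasis R L
  obtain ⟨i⟩ := b.index_nonempty
  refine ⟨TensorProduct.mk R Q M (b i), fun N _ _ _ => ?_⟩
  rw [injective_iff_map_eq_zero]
  intro t ht
  have h1 : (TensorProduct.leftComm R N Q M).toLinearMap ∘ₗ
      (TensorProduct.mk R Q M (b i)).lTensor N =
        L.subtype.rTensor (N ⊗[R] M) ∘ₗ TensorProduct.mk R L (N ⊗[R] M) (b i) := by
    ext; simp
  have h2 := LinearMap.congr_fun h1 t
  rw [LinearMap.comp_apply, ht, map_zero] at h2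
  have h3 := (injective_iff_map_eq_zero _).1 (hL (N ⊗[R] M)) (b i ⊗ₜ[R] t) h2.symm
  -- The coordinate at `i` recovers `t` from `b i ⊗ₜ t`.
  have h4 := congr(TensorProduct.lid R _ ((b.coord i).rTensor (N ⊗[R] M) $h3))
  simpa using h4

lemma HasFlatCoresolution.exists_isFlatStep_of_tensorProduct (hR : IsCoherentRing R)
    [Module.Flat R Q] {L : Submodule R Q} (hL : L.IsPureIn) (hbot : L ≠ ⊥) [Module.Free R L]
    {M : ModuleCat.{u} R} (h : HasFlatCoresolution R (Q ⊗[R] M)) :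
    ∃ C : ModuleCat.{u} R, IsFlatStep M C ∧ HasFlatCoresolution R (Q ⊗[R] C) := by
  obtain ⟨m, hm⟩ := hL.exists_testInjective (M := M) hbot
  obtain ⟨T, _, _, E, _, _, a, b, hT, hab, hE⟩ := h.exists_step
  have ham := (hab.testInjective.comp hm).isTestExact_mkQ
  exact ⟨ModuleCat.of R (T ⧸ LinearMap.range (a ∘ₗ m)),
    ⟨ModuleCat.of R T, a ∘ₗ m, _, hT, ham⟩, .of_isTestExact hR (ham.lTensor Q) h⟩

end FlatCoresolutions

/-! ### Totally acyclic complexes as spliced short exact sequences. -/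

section Complexes

variable {R : Type u} [CommRing R]

lemma ChainComplex.acyclic_iff_exact (K : ChainComplex (ModuleCat.{u} R) ℤ) :
    K.Acyclic ↔ ∀ i, Function.Exact (K.d (i + 1 + 1) (i + 1)) (K.d (i + 1) i) := by
  have key (i : ℤ) : K.ExactAt (i + 1) ↔
      Function.Exact (K.d (i + 1 + 1) (i + 1)) (K.d (i + 1) i) := by
    rw [K.exactAt_iff' (i + 1 + 1) (i + 1) i (by simp) (by simp),
      ShortComplex.ShortExact.moduleCat_exact_iff_function_exact]
    rfl
  refine ⟨fun h i => (key i).1 (h _), fun h i => ?_⟩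
  rw [← sub_add_cancel i 1, key]
  exact h _

lemma IsTotallyAcyclicFlat.lTensor_exact {T : ChainComplex (ModuleCat.{u} R) ℤ}
    (hT : IsTotallyAcyclicFlat T) (N : Type u) [AddCommGroup N] [Module R N]
    (hN : IsTestModule R N) (i : ℤ) :
    Function.Exact ((T.d (i + 1 + 1) (i + 1)).hom.lTensor N)
      ((T.d (i + 1) i).hom.lTensor N) := by
  obtain hN | ⟨⟨e⟩⟩ := hN
  · exact (ChainComplex.acyclic_iff_exact _).1 (hT.tensor_acyclic (ModuleCat.of R N) hN) i
  · have : Module.Flat R N := Module.Flat.of_linearEquiv e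
    exact Module.Flat.lTensor_exact N ((ChainComplex.acyclic_iff_exact _).1 hT.acyclic i)

/-- A totally acyclic complex of flat modules decomposes into short exact sequences. -/
lemma IsTotallyAcyclicFlat.isFlatStep {T : ChainComplex (ModuleCat.{u} R) ℤ}
    (hT : IsTotallyAcyclicFlat T) (i : ℤ) :
    IsFlatStep (ModuleCat.of R (T.X (i + 1) ⧸ LinearMap.range (T.d (i + 1 + 1) (i + 1)).hom))
      (ModuleCat.of R (T.X i ⧸ LinearMap.range (T.d (i + 1) i).hom)) := by
  let f := (LinearMap.range (T.d (i + 1 + 1) (i + 1)).hom).liftQ (T.d (i + 1) i).hom (by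
    rintro _ ⟨x, rfl⟩
    rw [LinearMap.mem_ker, ← LinearMap.comp_apply, ← ModuleCat.hom_comp, T.d_comp_d]
    rfl)
  refine ⟨T.X i, f, (LinearMap.range (T.d (i + 1) i).hom).mkQ, hT.flat i,
    fun N _ _ hN => ?_, ?_, Submodule.mkQ_surjective _⟩
  · rw [injective_iff_map_eq_zero]
    intro t ht
    obtain ⟨s, rfl⟩ := LinearMap.lTensor_surjective N (Submodule.mkQ_surjective _) t
    rw [← LinearMap.comp_apply, ← LinearMap.lTensor_comp, Submodule.liftQ_mkQ] at ht
    obtain ⟨r, rfl⟩ := (hT.lTensor_exact N hN i s).1 ht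
    rw [← LinearMap.comp_apply, ← LinearMap.lTensor_comp, LinearMap.range_mkQ_comp,
      LinearMap.lTensor_zero, LinearMap.zero_apply]
  · rw [LinearMap.exact_iff, Submodule.ker_mkQ, Submodule.range_liftQ]

/-- Short exact sequences with flat middle terms splice to a totally acyclic complex. -/
lemma isGorensteinFlat_of_flatSteps (S : ℤ → ModuleCat.{u} R)
    (hS : ∀ i, IsFlatStep (S (i + 1)) (S i)) : IsGorensteinFlat R (S 0) := by
  choose F f g hF hfg using hS
  let d (i : ℤ) : F (i + 1) ⟶ F i := ModuleCat.ofHom (f i ∘ₗ g (i + 1))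
  have hd (i : ℤ) : d (i + 1) ≫ d i = 0 := by
    ext x
    simp [d, (hfg (i + 1)).exact.apply_apply_eq_zero]
  let T := ChainComplex.of F d hd
  have hTd (i : ℤ) : (T.d (i + 1) i).hom = f i ∘ₗ g (i + 1) :=
    congrArg ModuleCat.Hom.hom (ChainComplex.of_d F d i)
  have hex (N : Type u) [AddCommGroup N] [Module R N] (hN : IsTestModule R N) (i : ℤ) :
      Function.Exact ((T.d (i + 1 + 1) (i + 1)).hom.lTensor N)
        ((T.d (i + 1) i).hom.lTensor N) := by
    rw [hTd, hTd, LinearMap.lTensor_comp, LinearMap.lTensor_comp]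
    refine (Function.Injective.comp_exact_iff_exact ((hfg i).testInjective N hN)).2 ?_
    refine (Function.Surjective.comp_exact_iff_exact
      (LinearMap.lTensor_surjective N (hfg _).surjective)).2 ?_
    exact _root_.lTensor_exact N (hfg _).exact (hfg _).surjective
  refine ⟨T, ⟨hF, ?_, fun N hN => ?_⟩, ⟨?_⟩⟩
  · rw [ChainComplex.acyclic_iff_exact]
    intro i
    refine (Module.FaithfullyFlat.lTensor_exact_iff_exact R R _ _).1
      (hex R (isTestModule_self R) i)
  · rw [ChainComplex.acyclic_iff_exact]
    exact hex N (Or.inl hN)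
  · have hker : LinearMap.range (T.d 1 0).hom = LinearMap.ker (g 0) := by
      rw [(hfg 0).exact.linearMap_ker_eq]
      refine (congrArg LinearMap.range (hTd 0)).trans ?_
      rw [LinearMap.range_comp_of_range_eq_top]
      exact LinearMap.range_eq_top.2 (hfg _).surjective
    exact (Submodule.quotEquivOfEq _ _ hker).trans
      ((g 0).quotKerEquivOfSurjective (hfg 0).surjective)

end Complexes

lemma exists_seq_of_forall_exists {α : Type*} {P : α → Prop} {r : α → α → Prop}
    (h : ∀ x, P x → ∃ y, r x y ∧ P y) {x : α} (hx : P x) :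
    ∃ s : ℕ → α, s 0 = x ∧ ∀ n, r (s n) (s (n + 1)) := by
  choose! next hr hP using h
  refine ⟨fun n => next^[n] x, rfl, fun n => ?_⟩
  have hn : P (next^[n] x) := by
    induction n with
    | zero => exact hx
    | succ n ih => rw [Function.iterate_succ_apply']; exact hP _ ih
  simp only [Function.iterate_succ_apply']
  exact hr _ hn

theorem mainTheorem5 (R : Type u) [CommRing R] (hR : IsCoherentRing R)
    (M : Type u) [AddCommGroup M] [Module R M]
    (h : ∃ (Q : Type u) (_ : AddCommGroup Q) (_ : Module R Q),
      Module.FaithfullyFlat R Q ∧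
      (∃ L : Submodule R Q, L ≠ ⊥ ∧ Module.Free R L ∧ L.IsPureIn) ∧
      IsGorensteinFlat R (Q ⊗[R] M)) :
    IsGorensteinFlat R M := by
  obtain ⟨Q, _, _, hQ, ⟨L, hbot, hfree, hL⟩, T, hT, ⟨e⟩⟩ := h
  let C (i : ℤ) := ModuleCat.of R (T.X i ⧸ LinearMap.range (T.d (i + 1) i).hom)
  have hC (i : ℤ) : IsFlatStep (C (i + 1)) (C i) := hT.isFlatStep i
  have hco : HasFlatCoresolution R (Q ⊗[R] M) :=
    HasFlatCoresolution.of_equiv (X := C 0) e ⟨fun Y => ∃ i, Y = C i, ⟨0, rfl⟩, by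
      rintro _ ⟨i, rfl⟩
      exact ⟨C (i - 1), by simpa using hC (i - 1), _, rfl⟩⟩
  have htor : TorVanish R (Q ⊗[R] M) :=
    TorVanish.of_equiv (X := C 0) e (torVanish_of_flatSteps (fun n => C n) fun n => hC n)
  obtain ⟨s, hs0, hs⟩ := exists_seq_of_forall_exists
    (P := fun X : ModuleCat.{u} R => TorVanish R X) (r := fun X Y => IsFlatStep Y X)
    (fun X hX => hX.exists_isFlatStep) (x := ModuleCat.of R M) (htor.of_tensorProduct Q)
  obtain ⟨t, ht0, ht⟩ := exists_seq_of_forall_exists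
    (P := fun X : ModuleCat.{u} R => HasFlatCoresolution R (Q ⊗[R] X)) (r := IsFlatStep)
    (fun X hX => hX.exists_isFlatStep_of_tensorProduct hR hL hbot) (x := ModuleCat.of R M) hco
  -- Both sequences start at `M`, so `t 0` is omitted and `.negSucc n`, that is $-(n+1)$, carries `t
  -- (n + 1)`.
  let S : ℤ → ModuleCat.{u} R
    | .ofNat n => s n
    | .negSucc n => t (n + 1)
  have hS : IsGorensteinFlat R (S 0) := by
    refine isGorensteinFlat_of_flatSteps S ?_
    rintro (n | n | n)
    · exact hs n
    · change IsFlatStep (s 0) (t 1)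
      rw [hs0, ← ht0]
      exact ht 0
    · exact ht (n + 1)
  change IsGorensteinFlat R (s 0) at hS
  rw [hs0] at hS
  exact hS
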